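/- For a finite simple graph $H$, a graph is called $H$-free if it has no induced subgraph isomorphic to $H$. Let $S_{2,2,2}$ be the tree with exactly three leaves, each at distance $2$ from the only vertex of degree $3$. A bipartite graph is called chordal bipartite if it has no induced cycle of length at least $6$. A class $\mathcal X$ of finite simple graphs admits an implicit representation if there are a constant $c$ and a function $D$ from pairs of finite binary words to $\{0,1\}$, both depending only on $\mathcal X$, such that for every $n \ge 1$ and every $n$-vertex graph $G \in \mathcal X$ one can assign to each vertex $v$ of $G$ a binary word $\ell(v)$ of length at most $c \lfloor \log_2 n \rfloor$ in such a way that any two distinct vertices $v, w$ of $G$ are adjacent if and only if $D(\ell(v),\ell(w)) = 1$. Theorem. The class of $S_{2,2,2}$-free chordal bipartite graphs admits an implicit representation. -/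

import Mathlib

universe u

/-- A class of graphs (considered as a property of graphs; only its finite members matter below). -/
abbrev GraphClass : Type (u + 1) := (V : Type u) → SimpleGraph V → Prop

/-- `G` is `H`-free: no induced subgraph of `G` is isomorphic to `H`. -/
def IsInducedFree {W : Type*} (H : SimpleGraph W) {V : Type*} (G : SimpleGraph V) : Prop :=
  ¬ H.IsIndContained G

/-- The tree `S_{2,2,2}`: centre `0`, and the three legs `0 - 1 - 2`, `0 - 3 - 4`, `0 - 5 - 6`,
so that its only vertex of degree 3 is `0` and its leaves `2`, `4`, `6` are at distance 2 from it. -/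
def spider222 : SimpleGraph (Fin 7) :=
  SimpleGraph.fromEdgeSet {s(0, 1), s(1, 2), s(0, 3), s(3, 4), s(0, 5), s(5, 6)}

/-- A bipartite graph is chordal bipartite if it has no chordless (that is, induced) cycle of
length at least 6. -/
def IsChordalBipartite {V : Type*} (G : SimpleGraph V) : Prop :=
  G.IsBipartite ∧ ∀ k : ℕ, 6 ≤ k → IsInducedFree (SimpleGraph.cycleGraph k) G

/-- The class `X` admits an implicit representation: there are a constant `c` and one decoder
`D`, both depending on the class `X` only, such that the vertices of every finite graph in `X`,
on `n` vertices say, can be given binary codes of length at most `c ⌊log₂ n⌋`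
in such a way that two vertices are adjacent exactly if `D` says so when given their codes. -/
def AdmitsImplicitRepresentation (X : GraphClass.{u}) : Prop :=
  ∃ (c : ℕ) (D : List Bool → List Bool → Bool),
    ∀ (V : Type u) [Finite V] (G : SimpleGraph V), X V G →
      ∃ code : V → List Bool,
        (∀ v, (code v).length ≤ c * Nat.log 2 (Nat.card V)) ∧
        ∀ v w, v ≠ w → (G.Adj v w ↔ D (code v) (code w) = true)

/-! Layer every component by the distance from a root. Edges join consecutive layers only, and an
edge between layers `i` and `i + 1` lies in one component of the graph on the layers from `i` on.
Fix such a component `K`.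

Chordal bipartiteness makes parent sets nested for vertices joined through later layers
(`IsLayering.nested`). Hence, if no two vertices of layer `i - 1` dominated the vertices of `K` in
layer `i`, three vertices of layer `i - 1` with private children would share a parent and span an
induced `S_{2,2,2}` (`IsLayering.exists_two_parents`). Among the children of one vertex `z`, an
induced matching of size 3 towards the next layer would also give a spider, centred at `z`. So the
edges leaving layer `i` in `K` split into two relations without induced matchings of size 3 and
without induced 6- and 8-cycles.

Each such relation is a union of two chain relations (`exists_two_thresholds`): the graph of
separated pairs of edges is 2-colourable, and each colour class extends to a maximal set of pairwise
touching edges, which is a chain. Membership in a chain compares two thresholds, so boundedly many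
numbers of size at most `n` per vertex decide adjacency. -/

/-! ### Covering a bipartite relation by two chain relations -/

section ChainCover

variable {α β : Type*}

/-- The bipartite relation `R` contains no induced cycle of length 6. -/
def NoHexagon (R : α → β → Prop) : Prop :=
  ∀ u₀ u₁ u₂ w₀ w₁ w₂, R u₀ w₀ → R u₁ w₀ → R u₁ w₁ → R u₂ w₁ → R u₂ w₂ → R u₀ w₂ →
    R u₀ w₁ ∨ R u₁ w₂ ∨ R u₂ w₀

/-- The bipartite relation `R` contains no induced cycle of length 8. -/
def NoOctagon (R : α → β → Prop) : Prop :=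
  ∀ u₀ u₁ u₂ u₃ w₀ w₁ w₂ w₃, R u₀ w₀ → R u₁ w₀ → R u₁ w₁ → R u₂ w₁ → R u₂ w₂ → R u₃ w₂ →
    R u₃ w₃ → R u₀ w₃ →
    R u₀ w₁ ∨ R u₀ w₂ ∨ R u₁ w₂ ∨ R u₁ w₃ ∨ R u₂ w₃ ∨ R u₂ w₀ ∨ R u₃ w₀ ∨ R u₃ w₁

/-- The bipartite relation `R` contains no induced matching with three edges. -/
def NoTripleMatching (R : α → β → Prop) : Prop :=
  ∀ u₀ u₁ u₂ w₀ w₁ w₂, R u₀ w₀ → R u₁ w₁ → R u₂ w₂ →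
    R u₀ w₁ ∨ R u₁ w₀ ∨ R u₀ w₂ ∨ R u₂ w₀ ∨ R u₁ w₂ ∨ R u₂ w₁

variable {R : α → β → Prop}

lemma NoHexagon.flip (h : NoHexagon R) : NoHexagon (flip R) := by
  intro u₀ u₁ u₂ w₀ w₁ w₂ h1 h2 h3 h4 h5 h6
  have := h w₀ w₁ w₂ u₁ u₂ u₀ h2 h3 h4 h5 h6 h1
  simp only [_root_.flip] at *
  tauto

lemma NoOctagon.flip (h : NoOctagon R) : NoOctagon (flip R) := by
  intro u₀ u₁ u₂ u₃ w₀ w₁ w₂ w₃ h1 h2 h3 h4 h5 h6 h7 h8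
  have := h w₀ w₁ w₂ w₃ u₁ u₂ u₃ u₀ h2 h3 h4 h5 h6 h7 h8 h1
  simp only [_root_.flip] at *
  tauto

lemma NoTripleMatching.flip (h : NoTripleMatching R) : NoTripleMatching (flip R) := by
  intro u₀ u₁ u₂ w₀ w₁ w₂ h1 h2 h3
  have := h w₀ w₁ w₂ u₀ u₁ u₂ h1 h2 h3
  simp only [_root_.flip] at *
  tauto

/-- Five edges that touch cyclically: the constraints imposed by the excluded patterns. -/
lemma pentagon_constraints (h6 : NoHexagon R) (h8 : NoOctagon R) (h3 : NoTripleMatching R)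
    {u₀ u₁ u₂ u₃ u₄ : α} {w₁ w₂ w₃ w₄ : β}
    (d1 : R u₁ w₁) (d2 : R u₂ w₂) (d3 : R u₃ w₃) (d4 : R u₄ w₄)
    (s02 : ¬ R u₀ w₂) (s13 : ¬ R u₁ w₃) (s31 : ¬ R u₃ w₁)
    (s24 : ¬ R u₂ w₄) (s42 : ¬ R u₄ w₂) (s03 : ¬ R u₀ w₃)
    (s41 : ¬ R u₄ w₁) (s14 : ¬ R u₁ w₄) :
    (R u₀ w₁ → R u₁ w₂ → R u₃ w₂ → R u₃ w₄ → R u₀ w₄ → False) ∧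
    (R u₀ w₁ → R u₂ w₁ → R u₃ w₂ → R u₄ w₃ → R u₀ w₄ → R u₂ w₃ ∨ R u₃ w₄) ∧
    (R u₀ w₁ → R u₁ w₂ → R u₃ w₂ → R u₄ w₃ → R u₀ w₄ → R u₃ w₄) ∧
    (R u₂ w₃ → R u₂ w₁ ∨ R u₄ w₃) := by
  refine ⟨fun a b c d e => ?_, fun a b c d e => ?_, fun a b c d e => ?_, fun a => ?_⟩
  · have := h6 u₀ u₁ u₃ w₁ w₂ w₄ a d1 b c d e
    tauto
  · have := h8 u₀ u₂ u₃ u₄ w₁ w₂ w₃ w₄ a b d2 c d3 d d4 e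
    tauto
  · have := h8 u₀ u₁ u₃ u₄ w₁ w₂ w₃ w₄ a d1 b c d3 d d4 e
    tauto
  · have := h3 u₁ u₂ u₄ w₁ w₃ w₄ d1 a d4
    tauto

/-- The constraints hold for all five rotations and after exchanging the two sides. The adjacencies
between consecutive edges are ten unknown propositions, and these instances are already
contradictory. -/
lemma no_separated_pentagon (h6 : NoHexagon R) (h8 : NoOctagon R) (h3 : NoTripleMatching R)
    {u₀ u₁ u₂ u₃ u₄ : α} {w₀ w₁ w₂ w₃ w₄ : β}
    (d0 : R u₀ w₀) (d1 : R u₁ w₁) (d2 : R u₂ w₂) (d3 : R u₃ w₃) (d4 : R u₄ w₄)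
    (s02 : ¬ R u₀ w₂) (s20 : ¬ R u₂ w₀) (s13 : ¬ R u₁ w₃) (s31 : ¬ R u₃ w₁)
    (s24 : ¬ R u₂ w₄) (s42 : ¬ R u₄ w₂) (s30 : ¬ R u₃ w₀) (s03 : ¬ R u₀ w₃)
    (s41 : ¬ R u₄ w₁) (s14 : ¬ R u₁ w₄)
    (t0 : R u₀ w₁ ∨ R u₁ w₀) (t1 : R u₁ w₂ ∨ R u₂ w₁) (t2 : R u₂ w₃ ∨ R u₃ w₂)
    (t3 : R u₃ w₄ ∨ R u₄ w₃) (t4 : R u₄ w₀ ∨ R u₀ w₄) : False := by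
  have A0 := pentagon_constraints h6 h8 h3 d1 d2 d3 d4 s02 s13 s31 s24 s42 s03 s41 s14
  have A1 := pentagon_constraints h6 h8 h3 d2 d3 d4 d0 s13 s24 s42 s30 s03 s14 s02 s20
  have A2 := pentagon_constraints h6 h8 h3 d3 d4 d0 d1 s24 s30 s03 s41 s14 s20 s13 s31
  have A3 := pentagon_constraints h6 h8 h3 d4 d0 d1 d2 s30 s41 s14 s02 s20 s31 s24 s42
  have A4 := pentagon_constraints h6 h8 h3 d0 d1 d2 d3 s41 s02 s20 s13 s31 s42 s30 s03
  have B0 := pentagon_constraints h6.flip h8.flip h3.flip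
    d1 d2 d3 d4 s20 s31 s13 s42 s24 s30 s14 s41
  have B1 := pentagon_constraints h6.flip h8.flip h3.flip
    d2 d3 d4 d0 s31 s42 s24 s03 s30 s41 s20 s02
  have B2 := pentagon_constraints h6.flip h8.flip h3.flip
    d3 d4 d0 d1 s42 s03 s30 s14 s41 s02 s31 s13
  have B3 := pentagon_constraints h6.flip h8.flip h3.flip
    d4 d0 d1 d2 s03 s14 s41 s20 s02 s13 s42 s24
  have B4 := pentagon_constraints h6.flip h8.flip h3.flip
    d0 d1 d2 d3 s14 s20 s02 s31 s13 s24 s03 s30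
  simp only [flip] at B0 B1 B2 B3 B4
  clear h6 h8 h3 d0 d1 d2 d3 d4 s02 s20 s13 s31 s24 s42 s30 s03 s41 s14
  generalize R u₀ w₁ = a0 at *
  generalize R u₁ w₀ = b0 at *
  generalize R u₁ w₂ = a1 at *
  generalize R u₂ w₁ = b1 at *
  generalize R u₂ w₃ = a2 at *
  generalize R u₃ w₂ = b2 at *
  generalize R u₃ w₄ = a3 at *
  generalize R u₄ w₃ = b3 at *
  generalize R u₄ w₀ = a4 at *
  generalize R u₀ w₄ = b4 at *
  grind

/-- In the hexagon `u₁ w₄ u₂ w₃ u₃ w₁` the two other long chords are excluded by separation. -/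
lemma crossing_pairs_aux (h6 : NoHexagon R)
    {u₁ u₂ u₃ : α} {w₁ w₃ w₄ : β}
    (d1 : R u₁ w₁) (d3 : R u₃ w₃)
    (s21 : ¬ R u₂ w₁) (s34 : ¬ R u₃ w₄)
    (h31 : R u₃ w₁) (h14 : R u₁ w₄) (h24 : R u₂ w₄) (h23 : R u₂ w₃) : R u₁ w₃ := by
  have := h6 u₁ u₂ u₃ w₄ w₃ w₁ h14 h24 h23 d3 h31 d1
  tauto

/-- Two pairs of separated edges touching each other span a complete bipartite pattern. -/
lemma crossing_pairs (h6 : NoHexagon R) (h8 : NoOctagon R)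
    {u₁ u₂ u₃ u₄ : α} {w₁ w₂ w₃ w₄ : β}
    (d1 : R u₁ w₁) (d2 : R u₂ w₂) (d3 : R u₃ w₃) (d4 : R u₄ w₄)
    (s12 : ¬ R u₁ w₂) (s21 : ¬ R u₂ w₁) (s34 : ¬ R u₃ w₄) (s43 : ¬ R u₄ w₃)
    (t13 : R u₁ w₃ ∨ R u₃ w₁) (t14 : R u₁ w₄ ∨ R u₄ w₁)
    (t23 : R u₂ w₃ ∨ R u₃ w₂) (t24 : R u₂ w₄ ∨ R u₄ w₂) :
    (R u₁ w₃ ∧ R u₁ w₄ ∧ R u₂ w₃ ∧ R u₂ w₄) ∨ (R u₃ w₁ ∧ R u₃ w₂ ∧ R u₄ w₁ ∧ R u₄ w₂) := by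
  have constraints : ∀ {u₁ u₂ u₃ u₄ : α} {w₁ w₂ w₃ w₄ : β}
      (_ : R u₁ w₁) (_ : R u₂ w₂) (_ : R u₃ w₃) (_ : R u₄ w₄)
      (_ : ¬ R u₁ w₂) (_ : ¬ R u₂ w₁) (_ : ¬ R u₃ w₄) (_ : ¬ R u₄ w₃),
      (R u₃ w₁ → R u₃ w₂ → R u₁ w₄ → R u₂ w₄ → False) ∧
      (R u₃ w₁ → R u₄ w₁ → R u₂ w₃ → R u₂ w₄ → False) ∧
      (R u₃ w₁ → R u₁ w₄ → R u₄ w₂ → R u₂ w₃ → R u₃ w₂ ∨ R u₄ w₁ ∨ R u₁ w₃ ∨ R u₂ w₄) := by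
    intro u₁ u₂ u₃ u₄ w₁ w₂ w₃ w₄ d1 d2 d3 d4 s12 s21 s34 s43
    refine ⟨fun a b c d => ?_, fun a b c d => ?_, fun a b c d => ?_⟩
    · have := h6 u₃ u₁ u₂ w₁ w₄ w₂ a d1 c d d2 b
      tauto
    · have := h6 u₃ u₄ u₂ w₁ w₄ w₃ a b d4 d c d3
      tauto
    · have := h8 u₃ u₁ u₄ u₂ w₁ w₄ w₂ w₃ a d1 b d4 c d2 d d3
      tauto
  -- The situation is symmetric under swapping the edges within either pair and under exchanging
  -- sides. These instances leave a propositional problem in eight unknowns.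
  have A1 := crossing_pairs_aux h6 d1 d3 s21 s34
  have A2 := crossing_pairs_aux h6 d2 d3 s12 s34
  have A3 := crossing_pairs_aux h6 d1 d4 s21 s43
  have A4 := crossing_pairs_aux h6 d2 d4 s12 s43
  have B1 := crossing_pairs_aux h6.flip d1 d3 s12 s43
  have B2 := crossing_pairs_aux h6.flip d2 d3 s21 s43
  have B3 := crossing_pairs_aux h6.flip d1 d4 s12 s34
  have B4 := crossing_pairs_aux h6.flip d2 d4 s21 s34
  have C1 := constraints d1 d2 d3 d4 s12 s21 s34 s43
  have C2 := constraints d2 d1 d3 d4 s21 s12 s34 s43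
  have C3 := constraints d1 d2 d4 d3 s12 s21 s43 s34
  have C4 := constraints d2 d1 d4 d3 s21 s12 s43 s34
  simp only [flip] at B1 B2 B3 B4
  clear constraints h6 h8 d1 d2 d3 d4 s12 s21 s34 s43
  generalize R u₁ w₃ = a13 at *
  generalize R u₃ w₁ = b13 at *
  generalize R u₁ w₄ = a14 at *
  generalize R u₄ w₁ = b14 at *
  generalize R u₂ w₃ = a23 at *
  generalize R u₃ w₂ = b23 at *
  generalize R u₂ w₄ = a24 at *
  generalize R u₄ w₂ = b24 at *
  grind

/-- This keeps the direction of joining constant when one of two joined pairs of edges is shifted by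
one step. The hexagon `u₁ w₃ u₂ w₂ u₅ w₁` forces `R u₅ w₃`, and then `u₅ w₃ u₁ w₄ u₄ w₂` has no
chord. -/
lemma no_mixed_crossing (h6 : NoHexagon R)
    {u₁ u₂ u₄ u₅ : α} {w₁ w₂ w₃ w₄ : β}
    (d1 : R u₁ w₁) (d2 : R u₂ w₂) (d4 : R u₄ w₄)
    (s12 : ¬ R u₁ w₂) (s21 : ¬ R u₂ w₁) (s43 : ¬ R u₄ w₃) (s54 : ¬ R u₅ w₄)
    (a13 : R u₁ w₃) (a23 : R u₂ w₃) (a14 : R u₁ w₄)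
    (b42 : R u₄ w₂) (b51 : R u₅ w₁) (b52 : R u₅ w₂) : False := by
  have e : R u₅ w₃ := by
    have := h6 u₁ u₂ u₅ w₃ w₂ w₁ a13 a23 d2 b52 b51 d1
    tauto
  have := h6 u₅ u₁ u₄ w₃ w₄ w₂ e a13 a14 d4 b42 b52
  tauto

end ChainCover

/-! ### Two-colouring the separated edges -/

section ChainCover

variable {α β : Type*} {R : α → β → Prop}

/-- The edges number `i, i + 1` and `j, j + 1` are joined completely, from the left ends of the
former to the right ends of the latter. -/
def JoinedPairs (R : α → β → Prop) (f : ℕ → α × β) (i j : ℕ) : Prop :=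
  R (f i).1 (f j).2 ∧ R (f i).1 (f (j + 1)).2 ∧
    R (f (i + 1)).1 (f j).2 ∧ R (f (i + 1)).1 (f (j + 1)).2

/-- Shifting the two pairs alternately preserves the direction of joining, so pair `i` is joined
towards pair `i + r` for every `i`. Going around the cycle reverses the roles: pair `r` is joined
towards pair `2 * r + 1`, which is pair `0`, against the original direction. The bound `3 ≤ r` keeps
the pairs far enough apart for the dichotomy at every shift. -/
lemma no_joinedPairs_of_separated_odd_cycle (h6 : NoHexagon R) (h8 : NoOctagon R) {r : ℕ}
    (hr : 3 ≤ r) (f : ℕ → α × β) (hR : ∀ i, R (f i).1 (f i).2)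
    (hsep : ∀ i, ¬ R (f i).1 (f (i + 1)).2 ∧ ¬ R (f (i + 1)).1 (f i).2)
    (htouch : ∀ i j, i + 2 ≤ j → j + 2 ≤ i + (2 * r + 1) →
      R (f i).1 (f j).2 ∨ R (f j).1 (f i).2)
    (h0 : f (2 * r + 1) = f 0) (h1 : f (2 * r + 2) = f 1) (h : JoinedPairs R f 0 r) : False := by
  have dich : ∀ i j, i + 3 ≤ j → j + 3 ≤ i + (2 * r + 1) →
      JoinedPairs R f i j ∨ JoinedPairs R f j i := by
    intro i j hij hji
    have := crossing_pairs h6 h8 (hR i) (hR (i + 1)) (hR j) (hR (j + 1)) (hsep i).1 (hsep i).2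
      (hsep j).1 (hsep j).2 (htouch i j (by omega) (by omega))
      (htouch i (j + 1) (by omega) (by omega)) (htouch (i + 1) j (by omega) (by omega))
      (htouch (i + 1) (j + 1) (by omega) (by omega))
    simp only [JoinedPairs]
    tauto
  have mixed : ∀ i j, JoinedPairs R f i j → JoinedPairs R f (j + 1) i → False := by
    intro i j h h'
    exact no_mixed_crossing h6 (hR i) (hR (i + 1)) (hR (j + 1)) (hsep i).1 (hsep i).2
      (hsep j).2 (hsep (j + 1)).2 h.1 h.2.2.1 h.2.1 h'.2.1 h'.2.2.1 h'.2.2.2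
  have mixed' : ∀ i j, JoinedPairs R f j i → JoinedPairs R f i (j + 1) → False := by
    intro i j h h'
    exact no_mixed_crossing h6.flip (hR i) (hR (i + 1)) (hR (j + 1)) (hsep i).2 (hsep i).1
      (hsep j).1 (hsep (j + 1)).1 h.1 h.2.1 h.2.2.1 h'.2.2.1 h'.2.1 h'.2.2.2
  have right : ∀ i, JoinedPairs R f i (i + r) → JoinedPairs R f i (i + r + 1) := by
    intro i h
    refine (dich i (i + r + 1) (by omega) (by omega)).resolve_right fun h' => mixed _ _ h h'
  have left : ∀ i, JoinedPairs R f i (i + r + 1) → JoinedPairs R f (i + 1) (i + r + 1) := by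
    intro i h
    exact (dich (i + 1) (i + r + 1) (by omega) (by omega)).resolve_right
      fun h' => mixed' _ _ h h'
  have all : ∀ i, JoinedPairs R f i (i + r) := by
    intro i
    induction i with
    | zero => simpa using h
    | succ i ih =>
      have := left i (right i ih)
      rwa [show i + r + 1 = i + 1 + r by omega] at this
  have wrap : JoinedPairs R f r 0 := by
    have h2 := right r (all r)
    rw [show r + r + 1 = 2 * r + 1 by omega] at h2
    simpa only [JoinedPairs, h0, h1, Nat.zero_add] using h2
  have h3 := right 0 (all 0)
  rw [Nat.zero_add] at h3
  exact mixed' _ _ wrap h3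

/-- There is no long odd cycle of edges in which exactly the consecutive edges are separated. -/
lemma no_separated_odd_cycle (h6 : NoHexagon R) (h8 : NoOctagon R) {r : ℕ} (hr : 3 ≤ r)
    (f : ℕ → α × β) (hR : ∀ i, R (f i).1 (f i).2)
    (hsep : ∀ i, ¬ R (f i).1 (f (i + 1)).2 ∧ ¬ R (f (i + 1)).1 (f i).2)
    (htouch : ∀ i j, i + 2 ≤ j → j + 2 ≤ i + (2 * r + 1) →
      R (f i).1 (f j).2 ∨ R (f j).1 (f i).2)
    (h0 : f (2 * r + 1) = f 0) (h1 : f (2 * r + 2) = f 1) : False := by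
  rcases crossing_pairs h6 h8 (hR 0) (hR 1) (hR r) (hR (r + 1)) (hsep 0).1 (hsep 0).2
      (hsep r).1 (hsep r).2 (htouch 0 r (by omega) (by omega))
      (htouch 0 (r + 1) (by omega) (by omega)) (htouch 1 r (by omega) (by omega))
      (htouch 1 (r + 1) (by omega) (by omega)) with h | h
  · exact no_joinedPairs_of_separated_odd_cycle h6 h8 hr f hR hsep htouch h0 h1 h
  -- The opposite direction becomes the first case after exchanging the two sides.
  · refine no_joinedPairs_of_separated_odd_cycle h6.flip h8.flip hr (fun i => (f i).swap) hR
      (fun i => (hsep i).symm) (fun i j hij hji => (htouch i j hij hji).symm) (by simp [h0])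
      (by simp [h1]) ⟨h.1, h.2.2.1, h.2.1, h.2.2.2⟩

/-- The graph on pairs in which two edges of `R` are adjacent if they are separated, that is, if
they form an induced matching. -/
def separationGraph (R : α → β → Prop) : SimpleGraph (α × β) where
  Adj e f := R e.1 e.2 ∧ R f.1 f.2 ∧ ¬ R e.1 f.2 ∧ ¬ R f.1 e.2
  symm := ⟨fun _ _ h => ⟨h.2.1, h.1, h.2.2.2, h.2.2.1⟩⟩
  loopless := ⟨fun _ h => h.2.2.1 h.1⟩

/-- A graph without odd cycles in which exactly the consecutive vertices are adjacent is
bipartite. -/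
lemma two_colorable_of_no_induced_odd_cycle {V : Type*} (H : SimpleGraph V)
    (h : ∀ (r : ℕ) (f : ℕ → V), 1 ≤ r → (∀ i, f (i + (2 * r + 1)) = f i) →
      (∀ i, H.Adj (f i) (f (i + 1))) →
      (∀ i j, i + 2 ≤ j → j + 2 ≤ i + (2 * r + 1) → ¬ H.Adj (f i) (f j)) → False) :
    H.Colorable 2 := by
  classical
  rw [SimpleGraph.two_colorable_iff_forall_loop_even]
  intro v p
  by_contra hodd
  have closed : ∀ (g : ℕ → V) (m : ℕ), 0 < m → (∀ i < m, H.Adj (g i) (g (i + 1))) →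
      g m = g 0 → ∀ i, H.Adj (g (i % m)) (g ((i + 1) % m)) := by
    intro g m hm hg h0 i
    have hlt := Nat.mod_lt i hm
    have := hg (i % m) hlt
    rw [Nat.add_mod]
    rcases (show i % m + 1 < m ∨ i % m + 1 = m by omega) with hc | hc
    · by_cases h1 : m = 1
      · omega
      · rwa [Nat.mod_eq_of_lt (show 1 < m by omega), Nat.mod_eq_of_lt hc]
    · rw [hc, h0] at this
      rcases (show m = 1 ∨ 1 < m by omega) with h1 | h1
      · subst h1
        exact absurd (hg 0 hm) (by rw [Nat.zero_add, h0]; exact H.loopless.irrefl _)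
      · rwa [Nat.mod_eq_of_lt h1, hc, Nat.mod_self]
  -- Odd closed walks are read as periodic sequences; a shortest one is taken.
  have hex : ∃ r, ∃ f : ℕ → V, (∀ i, f (i + (2 * r + 1)) = f i) ∧
      ∀ i, H.Adj (f i) (f (i + 1)) := by
    obtain ⟨r, hr⟩ := Nat.not_even_iff_odd.1 hodd
    refine ⟨r, fun i => p.getVert (i % (2 * r + 1)), fun i => by simp, ?_⟩
    refine closed p.getVert _ (by omega) (fun i hi => p.adj_getVert_succ (by omega)) ?_
    rw [← hr]
    simp
  obtain ⟨f, hper, hadj⟩ := Nat.find_spec hex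
  have hmin := fun r => Nat.find_min hex (m := r)
  generalize Nat.find hex = r at hper hadj hmin
  refine h r f ?_ hper hadj ?_
  · by_contra hr
    have h0 : r = 0 := by omega
    subst h0
    exact H.loopless.irrefl (f 1) (by simpa [hper] using hadj 0)
  · intro i j hij hji hc
    have shortcut : ∀ (a s : ℕ), s < r → H.Adj (f (a + 2 * s)) (f a) → False := by
      intro a s hs hadj'
      let g : ℕ → V := fun k => if k = 2 * s + 1 then f a else f (a + k)
      refine hmin s hs ⟨fun k => g (k % (2 * s + 1)), fun k => by simp, ?_⟩
      refine closed g _ (by omega) (fun k hk => ?_) (by simp [g])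
      rcases (show k = 2 * s ∨ k < 2 * s by omega) with rfl | hk'
      · simpa [g] using hadj'
      · have := hadj (a + k)
        simp only [g]
        rw [if_neg (by omega), if_neg (by omega)]
        exact this
    -- The period is odd, so one of the two arcs cut off by the chord is even; together with the
    -- chord it is a shorter odd closed walk.
    rcases Nat.even_or_odd' (j - i) with ⟨s, hs | hs⟩
    · exact shortcut i s (by omega) (by rw [show i + 2 * s = j by omega]; exact hc.symm)
    · refine shortcut j (r - s) (by omega) ?_
      rw [show j + 2 * (r - s) = i + (2 * r + 1) by omega, hper]
      exact hc

lemma separationGraph_two_colorable (h6 : NoHexagon R) (h8 : NoOctagon R)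
    (h3 : NoTripleMatching R) : (separationGraph R).Colorable 2 := by
  refine two_colorable_of_no_induced_odd_cycle _ fun r f hr hper hadj hnadj => ?_
  have hR : ∀ i, R (f i).1 (f i).2 := fun i => (hadj i).1
  have hsep : ∀ i, ¬ R (f i).1 (f (i + 1)).2 ∧ ¬ R (f (i + 1)).1 (f i).2 :=
    fun i => (hadj i).2.2
  have htouch : ∀ i j, i + 2 ≤ j → j + 2 ≤ i + (2 * r + 1) →
      R (f i).1 (f j).2 ∨ R (f j).1 (f i).2 := by
    intro i j hij hji
    have := hnadj i j hij hji
    simp only [separationGraph, hR] at this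
    tauto
  have h0 : f (2 * r + 1) = f 0 := by simpa using hper 0
  have h1 : f (2 * r + 2) = f 1 := by rw [← hper 1]; congr 1; omega
  rcases (show r = 1 ∨ r = 2 ∨ 3 ≤ r by omega) with rfl | rfl | hr
  · have h2 := hsep 2
    rw [h0] at h2
    have := h3 _ _ _ _ _ _ (hR 0) (hR 1) (hR 2)
    have s0 := hsep 0
    have s1 := hsep 1
    tauto
  · have s4 := hsep 4
    have s0 := hsep 0
    have s1 := hsep 1
    have s2 := hsep 2
    have s3 := hsep 3
    rw [h0] at s4
    have t02 := htouch 0 2 (by omega) (by omega)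
    have t24 := htouch 2 4 (by omega) (by omega)
    have t41 := htouch 4 6 (by omega) (by omega)
    rw [h1] at t41
    have t13 := htouch 1 3 (by omega) (by omega)
    have t30 := htouch 0 3 (by omega) (by omega)
    -- The complement of a 5-cycle is a 5-cycle: the edges touch in the order 0, 2, 4, 1, 3.
    exact no_separated_pentagon h6 h8 h3 (hR 0) (hR 2) (hR 4) (hR 1) (hR 3)
      s4.2 s4.1 s1.2 s1.1 s3.2 s3.1 s0.2 s0.1 s2.2 s2.1 t02 t24 t41 t13 t30.symm
  · exact no_separated_odd_cycle h6 h8 hr f hR hsep htouch h0 h1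

/-- A relation whose neighbourhoods are nested (the bipartite graph of a chain). -/
def IsChainRel (S : α → β → Prop) : Prop :=
  ∀ u u' w w', S u w → S u' w' → S u w' ∨ S u' w

/-- A maximal set of pairwise touching edges is a chain relation. -/
lemma isChainRel_of_maximal (h6 : NoHexagon R) {F : Set (α × β)}
    (hF : Maximal (fun F : Set (α × β) => ∀ e ∈ F, R e.1 e.2 ∧
      ∀ f ∈ F, R e.1 f.2 ∨ R f.1 e.2) F) :
    IsChainRel (fun u w => (u, w) ∈ F) := by
  intro u u' w w' h h'
  by_contra! hcon
  have ext : ∀ e : α × β, R e.1 e.2 → e ∉ F → ∃ g ∈ F, ¬ R e.1 g.2 ∧ ¬ R g.1 e.2 := by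
    intro e he heF
    by_contra! hall
    have : insert e F ⊆ F := by
      refine hF.2 ?_ (Set.subset_insert _ _)
      rintro x (rfl | hx)
      · refine ⟨he, ?_⟩
        rintro y (rfl | hy)
        · exact Or.inl he
        · have := hall y hy
          tauto
      · refine ⟨(hF.1 x hx).1, ?_⟩
        rintro y (rfl | hy)
        · have := hall x hx
          tauto
        · exact (hF.1 x hx).2 y hy
    exact heF (this (Set.mem_insert _ _))
  -- By maximality the missing edge `(u, w')` is separated from some `(p, q)` in `F`. As `(p, q)`
  -- touches both given edges, a hexagon arises whose only possible long chord is `(u', w)`.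
  have key : ∀ {u u' w w'}, (u, w) ∈ F → (u', w') ∈ F → (u, w') ∉ F → R u w' → R u' w ∧
      ∃ p q, (p, q) ∈ F ∧ R p w ∧ R u' q ∧ ¬ R p w' ∧ ¬ R u q := by
    intro u u' w w' h h' hn hr
    obtain ⟨⟨p, q⟩, hg, g1, g2⟩ := ext (u, w') hr hn
    have t1 := (hF.1 _ h).2 _ hg
    have t2 := (hF.1 _ h').2 _ hg
    simp only at g1 g2 t1 t2
    have hpw : R p w := by tauto
    have huq : R u' q := by tauto
    refine ⟨?_, p, q, hg, hpw, huq, g2, g1⟩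
    have := h6 u p u' w q w' (hF.1 _ h).1 hpw (hF.1 _ hg).1 huq (hF.1 _ h').1 hr
    tauto
  have main : ∀ {u u' w w'}, (u, w) ∈ F → (u', w') ∈ F → (u, w') ∉ F → (u', w) ∉ F →
      R u w' → False := by
    intro u u' w w' h h' hn hn' hr
    obtain ⟨hr', p, q, hg, a1, a2, a3, a4⟩ := key h h' hn hr
    obtain ⟨-, p', q', hg', b1, b2, b3, b4⟩ := key h' h hn' hr'
    -- The witnesses for the two missing edges both lie in `F`, hence touch; either way of touching
    -- closes a hexagon without long chords.
    rcases (hF.1 _ hg).2 _ hg' with t | t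
    · have := h6 p u u' q' w' q t b2 hr (hF.1 _ h').1 a2 (hF.1 _ hg).1
      tauto
    · have := h6 p' u' u q w q' t a2 hr' (hF.1 _ h).1 b2 (hF.1 _ hg').1
      tauto
  rcases (hF.1 _ h).2 _ h' with t | t
  · exact main h h' hcon.1 hcon.2 t
  · exact main h' h hcon.2 hcon.1 t

/-- A chain relation on a finite set is given by thresholds. -/
lemma IsChainRel.exists_threshold [Finite α] [Finite β] {S : α → β → Prop} (hS : IsChainRel S) :
    ∃ (a : α → ℕ) (b : β → ℕ), (∀ u, a u ≤ Nat.card β) ∧ (∀ w, b w ≤ Nat.card β) ∧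
      ∀ u w, S u w ↔ b w ≤ a u := by
  classical
  cases nonempty_fintype α
  cases nonempty_fintype β
  let N : α → Finset β := fun u => Finset.univ.filter (S u)
  have hlt : ∀ u u' w, S u w → ¬ S u' w → (N u').card < (N u).card := by
    intro u u' w h h'
    refine Finset.card_lt_card ⟨fun x hx => ?_, fun hsub => ?_⟩
    · simp only [N, Finset.mem_filter, Finset.mem_univ, true_and] at hx ⊢
      have := hS _ _ _ _ h hx
      tauto
    · have : w ∈ N u' := hsub (by simpa [N] using h)
      exact h' (by simpa [N] using this)
  -- The threshold of `w` is one more than the largest degree of a non-neighbour, and `0` if there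
  -- is none. It is at most `Nat.card β` because a non-neighbour misses `w`.
  refine ⟨fun u => (N u).card,
    fun w => (Finset.univ.filter fun u => ¬ S u w).sup fun u => (N u).card + 1, ?_, ?_, ?_⟩
  · intro u
    rw [Nat.card_eq_fintype_card]
    exact Finset.card_le_univ _
  · intro w
    refine Finset.sup_le fun u hu => ?_
    have hu' : ¬ S u w := by simpa using hu
    rw [Nat.card_eq_fintype_card]
    refine Finset.card_lt_univ_of_notMem (x := w) ?_
    simpa [N] using hu'
  · intro u w
    constructor
    · intro h
      refine Finset.sup_le fun u' hu' => ?_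
      exact hlt u u' w h (by simpa using hu')
    · intro h
      by_contra hn
      have : (N u).card + 1 ≤ _ := (Finset.le_sup (f := fun u => (N u).card + 1)
        (show u ∈ Finset.univ.filter fun u => ¬ S u w by simpa using hn))
      have := this.trans h
      simp at this

/-- A finite bipartite relation without induced matchings of size 3 and without induced cycles of
length 6 and 8 is the union of two chain relations. -/
theorem exists_two_thresholds [Finite α] [Finite β] (h6 : NoHexagon R) (h8 : NoOctagon R)
    (h3 : NoTripleMatching R) :
    ∃ (a : Fin 2 → α → ℕ) (b : Fin 2 → β → ℕ), (∀ k u, a k u ≤ Nat.card β) ∧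
      (∀ k w, b k w ≤ Nat.card β) ∧ ∀ u w, R u w ↔ ∃ k, b k w ≤ a k u := by
  obtain ⟨c⟩ := separationGraph_two_colorable h6 h8 h3
  -- Edges of one colour touch pairwise. The maximal extensions may overlap, which is harmless for a
  -- union.
  have hmax : ∀ k : Fin 2, ∃ F, {e : α × β | R e.1 e.2 ∧ c e = k} ≤ F ∧
      Maximal (fun F : Set (α × β) => ∀ e ∈ F, R e.1 e.2 ∧
        ∀ f ∈ F, R e.1 f.2 ∨ R f.1 e.2) F := by
    intro k
    refine Finite.exists_le_maximal ?_
    rintro e ⟨he, hc⟩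
    refine ⟨he, ?_⟩
    rintro f ⟨hf, hc'⟩
    by_contra! hcon
    exact c.valid (v := e) (w := f) ⟨he, hf, hcon⟩ (hc.trans hc'.symm)
  choose F hsub hF using hmax
  choose a b ha hb hab using fun k => (isChainRel_of_maximal h6 (hF k)).exists_threshold
  refine ⟨a, b, ha, hb, fun u w => ⟨fun h => ?_, ?_⟩⟩
  · exact ⟨c (u, w), (hab _ _ _).1 (hsub (c (u, w)) ⟨h, rfl⟩)⟩
  · rintro ⟨k, hk⟩
    exact ((hF k).1 _ ((hab _ _ _).2 hk)).1

end ChainCover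

/-! ### Coding tuples of numbers by binary words -/

/-- The numbers `a i`, written with `W` binary digits each, one after the other. -/
def encodeTuple {t : ℕ} (W : ℕ) (a : Fin t → ℕ) : List Bool :=
  List.ofFn fun k : Fin (t * W) => (a k.divNat).testBit k.modNat

lemma encodeTuple_injective {t : ℕ} (ht : 0 < t) {W W' : ℕ} {a a' : Fin t → ℕ}
    (ha : ∀ i, a i < 2 ^ W) (ha' : ∀ i, a' i < 2 ^ W')
    (h : encodeTuple W a = encodeTuple W' a') : a = a' := by
  have hW : W = W' := by
    have := congrArg List.length h
    simp only [encodeTuple, List.length_ofFn] at this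
    exact Nat.eq_of_mul_eq_mul_left ht this
  subst hW
  have hfun := List.ofFn_injective h
  funext i
  refine Nat.eq_of_testBit_eq fun j => ?_
  rcases lt_or_ge j W with hj | hj
  · have := congrFun hfun (finProdFinEquiv (i, ⟨j, hj⟩))
    have e1 : (finProdFinEquiv (i, (⟨j, hj⟩ : Fin W))).divNat = i :=
      congrArg Prod.fst (finProdFinEquiv.symm_apply_apply (i, (⟨j, hj⟩ : Fin W)))
    have e2 : (finProdFinEquiv (i, (⟨j, hj⟩ : Fin W))).modNat = ⟨j, hj⟩ :=
      congrArg Prod.snd (finProdFinEquiv.symm_apply_apply (i, (⟨j, hj⟩ : Fin W)))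
    simpa only [e1, e2] using this
  · have hp : 2 ^ W ≤ 2 ^ j := Nat.pow_le_pow_right (by norm_num) hj
    rw [Nat.testBit_lt_two_pow ((ha i).trans_le hp), Nat.testBit_lt_two_pow ((ha' i).trans_le hp)]

/-- A class of graphs whose adjacency is a fixed relation between tuples of numbers that are at
most the number of vertices admits an implicit representation. -/
theorem admitsImplicitRepresentation_of_tuples {X : GraphClass.{u}} {ι : Type*} [Finite ι]
    [Nonempty ι] (P : (ι → ℕ) → (ι → ℕ) → Prop)
    (h : ∀ (V : Type u) [Finite V] (G : SimpleGraph V), X V G →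
      ∃ f : V → ι → ℕ, (∀ v i, f v i ≤ Nat.card V) ∧
        ∀ v w, v ≠ w → (G.Adj v w ↔ P (f v) (f w))) :
    AdmitsImplicitRepresentation.{u} X := by
  classical
  obtain ⟨t, ⟨e⟩⟩ := Finite.exists_equiv_fin ι
  have ht : 0 < t := Fin.pos_iff_nonempty.2 (e.symm.nonempty)
  -- For `n ≥ 2`, a number at most `n` fits into `2 * Nat.log 2 n` digits. The decoder need not know
  -- this width: for `t > 0` the word length determines it.
  refine ⟨2 * t, fun x y => decide (∃ (W : ℕ) (a b : ι → ℕ), (∀ i, a i < 2 ^ W) ∧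
    (∀ i, b i < 2 ^ W) ∧ x = encodeTuple W (a ∘ e.symm) ∧ y = encodeTuple W (b ∘ e.symm) ∧
    P a b), ?_⟩
  intro V _ G hG
  obtain ⟨f, hf, hadj⟩ := h V G hG
  refine ⟨fun v => encodeTuple (2 * Nat.log 2 (Nat.card V)) (f v ∘ e.symm), fun v => ?_,
    fun v w hvw => ?_⟩
  · simp only [encodeTuple, List.length_ofFn]
    exact le_of_eq (by ring)
  · have hcard : 1 < Nat.card V := by
      have : Nontrivial V := ⟨v, w, hvw⟩
      exact Finite.one_lt_card
    have hlog : 1 ≤ Nat.log 2 (Nat.card V) := Nat.log_pos (by norm_num) hcard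
    have hlt : ∀ v i, f v i < 2 ^ (2 * Nat.log 2 (Nat.card V)) := fun v i =>
      ((hf v i).trans_lt (Nat.lt_pow_succ_log_self (by norm_num) _)).trans_le
        (Nat.pow_le_pow_right (by norm_num) (by omega))
    have inj : ∀ {W W'} {a b : ι → ℕ}, (∀ i, a i < 2 ^ W) → (∀ i, b i < 2 ^ W') →
        encodeTuple W (a ∘ e.symm) = encodeTuple W' (b ∘ e.symm) → a = b := by
      intro W W' a b ha hb hab
      exact e.symm.surjective.injective_comp_right
        (encodeTuple_injective ht (fun i => ha _) (fun i => hb _) hab)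
    rw [hadj v w hvw, decide_eq_true_iff]
    constructor
    · intro hP
      exact ⟨_, f v, f w, hlt v, hlt w, rfl, rfl, hP⟩
    · rintro ⟨W, a, b, ha, hb, h1, h2, hP⟩
      rwa [inj (hlt v) ha h1, inj (hlt w) hb h2]

/-! ### Induced cycles from shortest paths -/

section Holes

variable {V : Type*} {G : SimpleGraph V}

/-- A sequence of at least five vertices in which exactly the cyclically consecutive ones are
adjacent is an induced cycle. -/
lemma cycleGraph_isIndContained_of_sequence {m : ℕ} (hm : 5 ≤ m) (c : ℕ → V)
    (h : ∀ i j, i < j → j < m → (G.Adj (c i) (c j) ↔ j = i + 1 ∨ (i = 0 ∧ j = m - 1))) :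
    (SimpleGraph.cycleGraph m).IsIndContained G := by
  -- Injectivity follows from the adjacencies: from length 5 on, distinct vertices of a cycle have
  -- distinct neighbourhoods.
  have hne : ∀ i j, i < j → j < m → c i ≠ c j := by
    intro i j hij hj heq
    have h1 : G.Adj (c i) (c (i + 1)) := (h i (i + 1) (by omega) (by omega)).2 (Or.inl rfl)
    have hj2 : j = i + 2 := by
      rw [heq] at h1
      rcases (show i + 1 = j ∨ i + 1 < j by omega) with h2 | h2
      · rw [h2] at h1
        exact absurd h1 (G.loopless.irrefl _)
      · have := (h (i + 1) j h2 hj).1 h1.symm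
        omega
    rcases (show j + 1 < m ∨ j + 1 = m by omega) with h2 | h2
    · have h3 : G.Adj (c j) (c (j + 1)) := (h j (j + 1) (by omega) h2).2 (Or.inl rfl)
      rw [← heq] at h3
      have := (h i (j + 1) (by omega) h2).1 h3
      omega
    · have h3 : G.Adj (c (i - 1)) (c i) := (h (i - 1) i (by omega) (by omega)).2 (by omega)
      rw [heq] at h3
      have := (h (i - 1) j (by omega) hj).1 h3
      omega
  obtain ⟨n, rfl⟩ : ∃ n, m = n + 2 := ⟨m - 2, by omega⟩
  have hadj : ∀ i j : Fin (n + 2), i < j →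
      (G.Adj (c i) (c j) ↔ (SimpleGraph.cycleGraph (n + 2)).Adj i j) := by
    intro i j hij
    rw [h i j hij j.2, SimpleGraph.cycleGraph_adj']
    have hi := i.2
    have hj := j.2
    have hij' : (i : ℕ) < j := hij
    rw [Fin.sub_val_of_le hij.le, Fin.val_sub, Nat.mod_eq_of_lt (by omega)]
    omega
  refine ⟨⟨⟨fun i => c i, fun i j hij => ?_⟩, ?_⟩⟩
  · rcases lt_trichotomy i j with hlt | heq | hlt
    · exact absurd hij (hne i j hlt j.2)
    · exact heq
    · exact absurd hij.symm (hne j i hlt i.2)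
  · intro i j
    change G.Adj (c i) (c j) ↔ _
    rcases lt_trichotomy i j with hlt | heq | hlt
    · exact hadj i j hlt
    · subst heq
      simp
    · rw [SimpleGraph.adj_comm, hadj j i hlt, SimpleGraph.adj_comm]

/-- The graph obtained from `G` by keeping only the edges inside `S`. -/
def SimpleGraph.edgesWithin (G : SimpleGraph V) (S : Set V) : SimpleGraph V where
  Adj x y := G.Adj x y ∧ x ∈ S ∧ y ∈ S
  symm := ⟨fun _ _ h => ⟨h.1.symm, h.2.2, h.2.1⟩⟩
  loopless := ⟨fun _ h => G.loopless.irrefl _ h.1⟩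

lemma SimpleGraph.edgesWithin_mono (G : SimpleGraph V) {S T : Set V} (h : S ⊆ T) :
    G.edgesWithin S ≤ G.edgesWithin T :=
  fun _ _ hxy => ⟨hxy.1, h hxy.2.1, h hxy.2.2⟩

lemma SimpleGraph.edgesWithin_le (G : SimpleGraph V) (S : Set V) : G.edgesWithin S ≤ G :=
  fun _ _ hxy => hxy.1

lemma SimpleGraph.Walk.dist_getVert_of_length_eq_dist {a b : V} (p : G.Walk a b)
    (hp : p.length = G.dist a b) {j : ℕ} (hj : j ≤ p.length) : G.dist a (p.getVert j) = j := by
  have h1 : G.dist a (p.getVert j) ≤ j := by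
    have := SimpleGraph.dist_le (p.take j)
    rw [SimpleGraph.Walk.take_length] at this
    omega
  have h2 : G.dist (p.getVert j) b ≤ p.length - j := by
    have := SimpleGraph.dist_le (p.drop j)
    rwa [SimpleGraph.Walk.drop_length] at this
  have h3 := SimpleGraph.Reachable.dist_triangle_left (p.take j).reachable b
  omega

/-- In a chordal bipartite graph, if two neighbours of `u` are joined in a set `S`,
then each of them is at distance two in `S` from another neighbour of `u`. -/
lemma IsChordalBipartite.exists_common_neighbor (hG : IsChordalBipartite G) {S : Set V}
    {u a b : V} (ha : G.Adj u a) (hb : G.Adj u b) (hab : a ≠ b)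
    (hr : (G.edgesWithin S).Reachable a b) :
    ∃ b' c, b' ≠ a ∧ G.Adj u b' ∧ b' ∈ S ∧ c ∈ S ∧ G.Adj a c ∧ G.Adj c b' := by
  classical
  set H := G.edgesWithin S with hH
  -- Take a neighbour of `u` nearest to `a` within `S`. Parity excludes distances 1 and 3; at
  -- distance `n ≥ 4` the geodesic closed up through `u` would be an induced cycle of length `n + 2
  -- ≥ 6`.
  have hex : ∃ n, ∃ b, G.Adj u b ∧ a ≠ b ∧ H.Reachable a b ∧ H.dist a b = n :=
    ⟨_, b, hb, hab, hr, rfl⟩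
  obtain ⟨b', hub, hab', hr', hd⟩ := Nat.find_spec hex
  have hmin := fun n => Nat.find_min hex (m := n)
  generalize Nat.find hex = n at hd hmin
  obtain ⟨p, hp⟩ := hr'.exists_walk_length_eq_dist
  have hpn : p.length = n := hp.trans hd
  have hdist : ∀ j ≤ n, H.dist a (p.getVert j) = j := fun j hj =>
    p.dist_getVert_of_length_eq_dist hp (hpn ▸ hj)
  have hstep : ∀ j < n, H.Adj (p.getVert j) (p.getVert (j + 1)) := fun j hj =>
    p.adj_getVert_succ (hpn ▸ hj)
  have hp0 : p.getVert 0 = a := p.getVert_zero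
  have hpl : p.getVert n = b' := hpn ▸ p.getVert_length
  obtain ⟨col⟩ := hG.1
  have hcol : ∀ {x y}, G.Adj x y → (col x : ℕ) ≠ col y := fun h h' => col.valid h (Fin.ext h')
  have hn0 : n ≠ 0 := by
    rintro rfl
    exact hab' (hp0.symm.trans hpl)
  have hmem : ∀ j ≤ n, p.getVert j ∈ S := by
    intro j hj
    rcases (show j < n ∨ j = n by omega) with h | h
    · exact (hstep j h).2.1
    · have := (hstep (n - 1) (by omega)).2.2
      rwa [show n - 1 + 1 = j by omega] at this
  have hn1 : n ≠ 1 := by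
    rintro rfl
    have h1 := hcol (hstep 0 (by omega)).1
    rw [hp0, hpl] at h1
    have h2 := hcol ha
    have h3 := hcol hub
    have := (col u).2; have := (col a).2; have := (col b').2
    omega
  have hn3 : n ≠ 3 := by
    rintro rfl
    have h1 := hcol (hstep 0 (by omega)).1
    have h2 := hcol (hstep 1 (by omega)).1
    have h3 := hcol (hstep 2 (by omega)).1
    rw [hp0] at h1
    simp only [Nat.reduceAdd, hpl] at h1 h2 h3
    have h4 := hcol ha
    have h5 := hcol hub
    have := (col u).2; have := (col a).2; have := (col b').2
    have := (col (p.getVert 1)).2; have := (col (p.getVert 2)).2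
    omega
  by_cases hn2 : n = 2
  · subst hn2
    have h0 := hstep 0 (by omega)
    have h1 := hstep 1 (by omega)
    rw [hp0] at h0
    simp only [Nat.reduceAdd, hpl] at h0 h1
    exact ⟨b', p.getVert 1, hab'.symm, hub, h1.2.2, h1.2.1, h0.1, h1.1⟩
  exfalso
  refine hG.2 (n + 2) (by omega) (cycleGraph_isIndContained_of_sequence (by omega)
    (fun i => if i = n + 1 then u else p.getVert i) ?_)
  intro i j hij hj
  rw [if_neg (show i ≠ n + 1 by omega)]
  by_cases hjn : j = n + 1
  · rw [if_pos hjn]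
    constructor
    · intro hadj
      by_contra hcon
      refine hmin i (by omega) ⟨p.getVert i, hadj.symm, ?_, (p.take i).reachable, hdist i (by omega)⟩
      intro hai
      have := hdist i (by omega)
      rw [← hai, SimpleGraph.dist_self] at this
      omega
    · rintro (h | h)
      · rw [show i = n by omega, hpl]
        exact hub.symm
      · rw [h.1, hp0]
        exact ha.symm
  · rw [if_neg hjn]
    constructor
    · intro hadj
      have hadj' : H.Adj (p.getVert i) (p.getVert j) := ⟨hadj, hmem i (by omega), hmem j (by omega)⟩
      have h1 := hdist i (by omega)
      have h2 := hdist j (by omega)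
      have h3 := SimpleGraph.Reachable.dist_triangle_left (p.take i).reachable (p.getVert j)
      rw [SimpleGraph.dist_eq_one_iff_adj.2 hadj'] at h3
      omega
    · rintro (h | h)
      · subst h
        exact (hstep i (by omega)).1
      · omega

end Holes

/-! ### Distance layering -/

section Layers

variable {V : Type*} {G : SimpleGraph V}

/-- `d` is the distance from a root chosen in every connected component of a bipartite graph. -/
structure IsLayering (G : SimpleGraph V) (d : V → ℕ) : Prop where
  adj : ∀ x y, G.Adj x y → d y = d x + 1 ∨ d x = d y + 1
  down : ∀ x, d x ≠ 0 → ∃ y, G.Adj x y ∧ d x = d y + 1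
  root : ∀ x y, d x = 0 → d y = 0 → G.Reachable x y → x = y

lemma exists_isLayering [Finite V] (hG : G.IsBipartite) :
    ∃ d, IsLayering G d ∧ ∀ v, d v ≤ Nat.card V := by
  classical
  cases nonempty_fintype V
  let root : V → V := fun v => (G.connectedComponentMk v).out
  have hroot : ∀ v, G.Reachable (root v) v := fun v =>
    SimpleGraph.ConnectedComponent.exact (Quot.out_eq (G.connectedComponentMk v))
  have hsame : ∀ {x y}, G.Reachable x y → root x = root y := fun h => by
    simp only [root, SimpleGraph.ConnectedComponent.sound h]
  obtain ⟨col⟩ := hG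
  let c : G.Coloring Bool := G.recolorOfEquiv finTwoEquiv col
  have hpar : ∀ {x y}, G.Reachable x y → (Even (G.dist x y) ↔ (c x ↔ c y)) := by
    intro x y h
    obtain ⟨p, hp⟩ := h.exists_walk_length_eq_dist
    rw [← hp]
    exact c.even_length_iff_congr p
  refine ⟨fun v => G.dist (root v) v, ⟨fun x y h => ?_, fun x hx => ?_, fun x y hx hy h => ?_⟩,
    fun v => ?_⟩
  · have hr := hroot x
    have hrxy : root y = root x := hsame h.symm.reachable
    rw [hrxy]
    have h1 := (hr.dist_triangle_left y)
    rw [SimpleGraph.dist_eq_one_iff_adj.2 h] at h1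
    have h2 := ((hr.trans h.reachable).dist_triangle_left x)
    rw [SimpleGraph.dist_eq_one_iff_adj.2 h.symm] at h2
    have h3 : G.dist (root x) y ≠ G.dist (root x) x := by
      intro heq
      have e1 := hpar hr
      have e2 := hpar (hr.trans h.reachable)
      rw [heq] at e2
      have := c.valid h
      revert this
      rcases hcx : c x <;> rcases hcy : c y <;> simp_all
    omega
  · obtain ⟨p, hp⟩ := (hroot x).exists_walk_length_eq_dist
    have hlen : p.length - 1 + 1 = p.length := by omega
    have hadj := p.adj_getVert_succ (show p.length - 1 < p.length by omega)
    rw [hlen, p.getVert_length] at hadj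
    refine ⟨_, hadj.symm, ?_⟩
    rw [hsame hadj.reachable, p.dist_getVert_of_length_eq_dist hp (by omega)]
    omega
  · have hxy := hsame h
    rw [(hroot x).dist_eq_zero_iff] at hx
    rw [(hroot y).dist_eq_zero_iff] at hy
    rw [← hx, ← hy, hxy]
  · obtain ⟨p, hp, hd⟩ := (hroot v).exists_path_of_dist
    change G.dist (root v) v ≤ _
    rw [← hd, Nat.card_eq_fintype_card]
    exact hp.length_lt.le

end Layers

/-! ### Parents of a component of the later layers -/

section Layers

variable {V : Type*} {G : SimpleGraph V}

lemma spider222_adj_iff (i j : Fin 7) : spider222.Adj i j ↔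
    (i = 0 ∧ (j = 1 ∨ j = 3 ∨ j = 5)) ∨ (j = 0 ∧ (i = 1 ∨ i = 3 ∨ i = 5)) ∨
    (i = 1 ∧ j = 2) ∨ (i = 2 ∧ j = 1) ∨ (i = 3 ∧ j = 4) ∨ (i = 4 ∧ j = 3) ∨
    (i = 5 ∧ j = 6) ∨ (i = 6 ∧ j = 5) := by
  simp only [spider222, SimpleGraph.fromEdgeSet_adj, Set.mem_insert_iff, Set.mem_singleton_iff,
    Sym2.eq_iff]
  revert i j
  decide

instance : DecidableRel spider222.Adj := fun i j => decidable_of_iff _ (spider222_adj_iff i j).symm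

lemma spider222_isIndContained {z a₁ a₂ a₃ b₁ b₂ b₃ : V} {d : V → ℕ} (hd : IsLayering G d)
    {i : ℕ} (hz : d z = i) (ha₁ : d a₁ = i + 1) (ha₂ : d a₂ = i + 1) (ha₃ : d a₃ = i + 1)
    (hb₁ : d b₁ = i + 2) (hb₂ : d b₂ = i + 2) (hb₃ : d b₃ = i + 2)
    (z₁ : G.Adj z a₁) (z₂ : G.Adj z a₂) (z₃ : G.Adj z a₃)
    (e₁ : G.Adj a₁ b₁) (e₂ : G.Adj a₂ b₂) (e₃ : G.Adj a₃ b₃)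
    (n₁₂ : ¬ G.Adj a₁ b₂) (n₁₃ : ¬ G.Adj a₁ b₃) (n₂₁ : ¬ G.Adj a₂ b₁) (n₂₃ : ¬ G.Adj a₂ b₃)
    (n₃₁ : ¬ G.Adj a₃ b₁) (n₃₂ : ¬ G.Adj a₃ b₂) : spider222.IsIndContained G := by
  have far : ∀ {x y}, d y ≠ d x + 1 → d x ≠ d y + 1 → ¬ G.Adj x y := fun h1 h2 h =>
    (hd.adj _ _ h).elim h1 h2
  have hzb : ∀ {y}, d y = i + 2 → ¬ G.Adj z y := fun h => far (by omega) (by omega)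
  have haa : ∀ {x y}, d x = i + 1 → d y = i + 1 → ¬ G.Adj x y :=
    fun h h' => far (by omega) (by omega)
  have hbb : ∀ {x y}, d x = i + 2 → d y = i + 2 → ¬ G.Adj x y :=
    fun h h' => far (by omega) (by omega)
  let f : Fin 7 → V := ![z, a₁, b₁, a₂, b₂, a₃, b₃]
  have hlt : ∀ i j : Fin 7, i < j → (G.Adj (f i) (f j) ↔ spider222.Adj i j) := by
    intro i j hij
    rw [spider222_adj_iff]
    fin_cases i <;> fin_cases j <;> first
      | exact absurd hij (by decide)
      | exact iff_of_true ‹_› (by decide)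
      | refine iff_of_false ?_ (by decide)
        first
        | assumption
        | exact hzb ‹_›
        | exact haa ‹_› ‹_›
        | exact hbb ‹_› ‹_›
        | exact fun h => absurd h.symm ‹_›
  have hadj : ∀ i j : Fin 7, G.Adj (f i) (f j) ↔ spider222.Adj i j := by
    intro i j
    rcases lt_trichotomy i j with h | h | h
    · exact hlt i j h
    · subst h
      simp
    · rw [SimpleGraph.adj_comm, hlt j i h, SimpleGraph.adj_comm]
  -- Distinct vertices of the spider have distinct neighbourhoods, so preserving adjacency both ways
  -- forces injectivity.
  have hinj : ∀ i j : Fin 7, (∀ k, spider222.Adj i k ↔ spider222.Adj j k) → i = j := by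
    decide
  refine ⟨⟨⟨f, fun i j hij => hinj i j fun k => ?_⟩, hadj _ _⟩⟩
  rw [← hadj, ← hadj, hij]

/-- Every vertex is joined to a root by a path descending through the layers. -/
lemma IsLayering.descend {d : V → ℕ} (hd : IsLayering G d) (x : V) :
    ∃ r, d r = 0 ∧ (G.edgesWithin {y | y = x ∨ d y < d x}).Reachable x r := by
  induction h : d x generalizing x with
  | zero => exact ⟨x, h, SimpleGraph.Reachable.refl _⟩
  | succ n ih =>
    obtain ⟨y, hxy, hy⟩ := hd.down x (by omega)
    obtain ⟨r, hr, hyr⟩ := ih y (by omega)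
    refine ⟨r, hr, SimpleGraph.Reachable.trans (v := y) ?_ (hyr.mono ?_)⟩
    · refine SimpleGraph.Adj.reachable ⟨hxy, Or.inl rfl, Or.inr ?_⟩
      omega
    · refine G.edgesWithin_mono ?_
      rintro z (rfl | hz)
      · right; omega
      · have hz' : d z < n := hz
        exact Or.inr (by omega)

/-- Two vertices of a layer joined through the later layers have nested neighbourhoods in the
previous layer. -/
lemma IsLayering.nested {d : V → ℕ} (hd : IsLayering G d) (hG : IsChordalBipartite G) {i : ℕ}
    {u v x y : V} (hu : d u = i + 1) (hv : d v = i + 1) (hux : G.Adj u x) (hvy : G.Adj v y)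
    (hx : d x = i + 2) (hy : d y = i + 2)
    (hxy : (G.edgesWithin {z | i + 2 ≤ d z}).Reachable x y) :
    (∀ p, d p = i → G.Adj u p → G.Adj v p) ∨ (∀ p, d p = i → G.Adj v p → G.Adj u p) := by
  by_contra! hcon
  obtain ⟨⟨p, hp, hup, hvp⟩, ⟨q, hq, hvq, huq⟩⟩ := hcon
  -- In `S`, the only neighbour of `u` below its layer is `p`, and the only vertex in the layer of
  -- `u` is `v`. Still, `p` reaches `x` inside `S` through the root, `q`, `v` and `y`. A path of
  -- length two from `p` to another neighbour of `u` would have to pass through `v`, which is not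
  -- adjacent to `p`.
  let S : Set V := {z | (d z < i + 1 ∧ ¬ G.Adj u z) ∨ z = p ∨ z = v ∨ i + 2 ≤ d z}
  have below : ∀ z, d z = i → z ∈ S → {y | y = z ∨ d y < d z} ⊆ S := by
    rintro z hz hzS w (rfl | hw)
    · exact hzS
    · have hw' : d w < d z := hw
      refine Or.inl ⟨by omega, fun h => ?_⟩
      have := hd.adj _ _ h
      omega
  have hpS : p ∈ S := Or.inr (Or.inl rfl)
  have hqS : q ∈ S := Or.inl ⟨by omega, huq⟩
  have hvS : v ∈ S := Or.inr (Or.inr (Or.inl rfl))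
  have hyS : y ∈ S := Or.inr (Or.inr (Or.inr hy.ge))
  obtain ⟨r, hr, hpr⟩ := hd.descend p
  obtain ⟨s, hs, hqs⟩ := hd.descend q
  have hpr' := hpr.mono (G.edgesWithin_mono (below p hp hpS))
  have hqs' := hqs.mono (G.edgesWithin_mono (below q hq hqS))
  have hvy' : (G.edgesWithin S).Reachable v y := SimpleGraph.Adj.reachable ⟨hvy, hvS, hyS⟩
  have hqv' : (G.edgesWithin S).Reachable q v := SimpleGraph.Adj.reachable ⟨hvq.symm, hqS, hvS⟩
  have hyx' : (G.edgesWithin S).Reachable y x :=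
    (hxy.mono (G.edgesWithin_mono fun z hz => Or.inr (Or.inr (Or.inr hz)))).symm
  have hqx' := (hqv'.trans hvy').trans hyx'
  have hle := G.edgesWithin_le S
  have hrs : r = s := by
    refine hd.root r s hr hs ?_
    have h1 : G.Reachable r p := (hpr'.mono hle).symm
    have h2 : G.Reachable x q := (hqx'.mono hle).symm
    exact ((h1.trans hup.symm.reachable).trans hux.reachable).trans (h2.trans (hqs'.mono hle))
  subst hrs
  have hpx : p ≠ x := by
    rintro rfl
    omega
  obtain ⟨b, c, hbp, hub, hbS, hcS, hpc, hcb⟩ := hG.exists_common_neighbor hup hux hpx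
    ((hpr'.trans hqs'.symm).trans hqx')
  have l1 := hd.adj _ _ hub
  have l2 := hd.adj _ _ hpc
  have l3 := hd.adj _ _ hcb
  have hb : i + 2 ≤ d b := by
    rcases hbS with h | h | h | h
    · exact absurd hub h.2
    · exact absurd h hbp
    · subst h; omega
    · exact h
  rcases hcS with h | h | h | h
  · omega
  · subst h; omega
  · subst h; exact hvp hpc.symm
  · omega

/-- Three vertices of a layer that are joined through the later layers have a common neighbour in
the previous layer. -/
lemma IsLayering.exists_common_parent {d : V → ℕ} (hd : IsLayering G d)
    (hG : IsChordalBipartite G) {i : ℕ} {u v w x y z : V}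
    (hu : d u = i + 1) (hv : d v = i + 1) (hw : d w = i + 1)
    (hux : G.Adj u x) (hvy : G.Adj v y) (hwz : G.Adj w z)
    (hx : d x = i + 2) (hy : d y = i + 2) (hz : d z = i + 2)
    (hxy : (G.edgesWithin {z | i + 2 ≤ d z}).Reachable x y)
    (hxz : (G.edgesWithin {z | i + 2 ≤ d z}).Reachable x z) :
    ∃ p, d p = i ∧ G.Adj p u ∧ G.Adj p v ∧ G.Adj p w := by
  have parent : ∀ t, d t = i + 1 → ∃ p, d p = i ∧ G.Adj t p := by
    intro t ht
    obtain ⟨p, h1, h2⟩ := hd.down t (by omega)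
    exact ⟨p, by omega, h1⟩
  obtain ⟨p, hp, hup⟩ := parent u hu
  obtain ⟨q, hq, hvq⟩ := parent v hv
  obtain ⟨r, hr, hwr⟩ := parent w hw
  have huv := hd.nested hG hu hv hux hvy hx hy hxy
  have huw := hd.nested hG hu hw hux hwz hx hz hxz
  have hvw := hd.nested hG hv hw hvy hwz hy hz (hxy.symm.trans hxz)
  have concl : ∀ p, d p = i → G.Adj u p → G.Adj v p → G.Adj w p →
      ∃ p, d p = i ∧ G.Adj p u ∧ G.Adj p v ∧ G.Adj p w := fun p hp h1 h2 h3 =>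
    ⟨p, hp, h1.symm, h2.symm, h3.symm⟩
  -- The three parent sets are nonempty and pairwise nested, so the least one consists of common
  -- parents.
  rcases huv with h1 | h1
  · rcases huw with h2 | h2
    · exact concl p hp hup (h1 p hp hup) (h2 p hp hup)
    · exact concl r hr (h2 r hr hwr) (h1 r hr (h2 r hr hwr)) hwr
  · rcases hvw with h2 | h2
    · exact concl q hq (h1 q hq hvq) hvq (h2 q hq hvq)
    · exact concl r hr (h1 r hr (h2 r hr hwr)) (h2 r hr hwr) hwr

/-- The vertices of a layer in one component of the later layers have neighbours among two
vertices of the previous layer. -/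
lemma IsLayering.exists_two_parents [Finite V] {d : V → ℕ} (hd : IsLayering G d)
    (hG : IsChordalBipartite G) (hS : IsInducedFree spider222 G) (i : ℕ) (u₀ : V)
    (hu₀ : d u₀ = i + 1) :
    ∃ p q, d p = i ∧ d q = i ∧ ∀ u, d u = i + 1 →
      (G.edgesWithin {z | i + 1 ≤ d z}).Reachable u₀ u → G.Adj p u ∨ G.Adj q u := by
  classical
  cases nonempty_fintype V
  obtain ⟨p₀, hp₀, hd₀⟩ := hd.down u₀ (by omega)
  rcases i with _ | i
  · refine ⟨p₀, p₀, by omega, by omega, fun u hu hr => Or.inl ?_⟩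
    obtain ⟨p, hp, hdp⟩ := hd.down u (by omega)
    have : p = p₀ := by
      refine hd.root _ _ (by omega) (by omega) ?_
      exact (hp.symm.reachable.trans (hr.mono (G.edgesWithin_le _)).symm).trans hp₀.reachable
    rw [← this]
    exact hp.symm
  · let U : Finset V := Finset.univ.filter fun u => d u = i + 1 + 1 ∧
      (G.edgesWithin {z | i + 1 + 1 ≤ d z}).Reachable u₀ u
    let P : Finset V := Finset.univ.filter fun p => d p = i + 1
    have hP : ∀ {p}, p ∈ P ↔ d p = i + 1 := by simp [P]
    have hU : ∀ {u}, u ∈ U ↔ d u = i + 1 + 1 ∧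
      (G.edgesWithin {z | i + 1 + 1 ≤ d z}).Reachable u₀ u := by simp [U]
    let cov : V × V → Finset V := fun e => U.filter fun u => G.Adj e.1 u ∨ G.Adj e.2 u
    have hcov : ∀ {e u}, u ∈ cov e ↔ u ∈ U ∧ (G.Adj e.1 u ∨ G.Adj e.2 u) := by simp [cov]
    -- Choose a pair of parents covering as many vertices as possible.
    obtain ⟨⟨p, q⟩, hpq, hmax⟩ := Finset.exists_max_image (P ×ˢ P) (fun e => (cov e).card)
      ⟨(p₀, p₀), Finset.mk_mem_product (hP.2 (by omega)) (hP.2 (by omega))⟩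
    obtain ⟨hp, hq⟩ := Finset.mem_product.1 hpq
    refine ⟨p, q, hP.1 hp, hP.1 hq, fun u hu hr => ?_⟩
    by_contra! hcon
    obtain ⟨r, hur, hr'⟩ := hd.down u (by omega)
    have hrP : r ∈ P := hP.2 (by omega)
    have huU : u ∈ U := hU.2 ⟨hu, hr⟩
    -- If `s` had no private vertex with respect to `t` and `r`, replacing `s` by `r` would lose
    -- nothing and gain `u`.
    have exchange : ∀ s t, (s = p ∧ t = q ∨ s = q ∧ t = p) →
        ∃ v ∈ U, G.Adj s v ∧ ¬ G.Adj t v ∧ ¬ G.Adj r v := by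
      intro s t hst
      by_contra! hall
      have htP : t ∈ P := by rcases hst with h | h <;> rw [h.2] <;> assumption
      have hle := hmax (t, r) (Finset.mk_mem_product htP hrP)
      refine absurd hle (not_le.2 (Finset.card_lt_card ⟨fun v hv => ?_, fun hsub => ?_⟩))
      · rw [hcov] at hv ⊢
        refine ⟨hv.1, ?_⟩
        have h1 := hall v hv.1
        have h2 := hv.2
        rcases hst with ⟨rfl, rfl⟩ | ⟨rfl, rfl⟩ <;> tauto
      · have h1 : u ∈ cov (p, q) := hsub (hcov.2 ⟨huU, Or.inr hur.symm⟩)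
        have h2 := (hcov.1 h1).2
        tauto
    obtain ⟨v, hvU, h1, h2, h3⟩ := exchange p q (Or.inl ⟨rfl, rfl⟩)
    obtain ⟨w, hwU, k1, k2, k3⟩ := exchange q p (Or.inr ⟨rfl, rfl⟩)
    obtain ⟨hv, hvr⟩ := hU.1 hvU
    obtain ⟨hw, hwr⟩ := hU.1 hwU
    obtain ⟨z, hz, zp, zq, zr⟩ := hd.exists_common_parent hG (hP.1 hp) (hP.1 hq) (hP.1 hrP)
      h1 k1 hur.symm hv hw hu (hvr.symm.trans hwr) (hvr.symm.trans hr)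
    exact hS (spider222_isIndContained hd hz (hP.1 hp) (hP.1 hq) (hP.1 hrP) hv hw hu zp zq zr
      h1 k1 hur.symm k2 hcon.1 h2 hcon.2 h3 k3)

end Layers

/-! ### Edges between consecutive layers -/

section Layers

variable {V : Type*} {G : SimpleGraph V}

/-- The edges between the layers `i` and `i + 1` whose end in the layer `i` satisfies `Q`. -/
def layerRel (G : SimpleGraph V) (d : V → ℕ) (i : ℕ) (Q : V → Prop) (u w : V) : Prop :=
  G.Adj u w ∧ d u = i ∧ d w = i + 1 ∧ Q u

/-- There is no induced cycle of length `2 k ≥ 6` alternating between two layers. -/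
lemma layerRel_no_cycle (hG : IsChordalBipartite G) {d : V → ℕ} (hd : IsLayering G d) {i : ℕ}
    {Q : V → Prop} {k : ℕ} (hk : 3 ≤ k) (u w : ℕ → V)
    (h : ∀ a < k, ∀ b < k, (layerRel G d i Q (u a) (w b) ↔
      a = b ∨ a = b + 1 ∨ (a = 0 ∧ b + 1 = k))) : False := by
  have hu : ∀ a < k, d (u a) = i := fun a ha => ((h a ha a ha).2 (Or.inl rfl)).2.1
  have hQ : ∀ a < k, Q (u a) := fun a ha => ((h a ha a ha).2 (Or.inl rfl)).2.2.2
  have hw : ∀ a < k, d (w a) = i + 1 := fun a ha => ((h a ha a ha).2 (Or.inl rfl)).2.2.1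
  have huw : ∀ a < k, ∀ b < k, (G.Adj (u a) (w b) ↔
      a = b ∨ a = b + 1 ∨ (a = 0 ∧ b + 1 = k)) := by
    intro a ha b hb
    rw [← h a ha b hb]
    exact ⟨fun hadj => ⟨hadj, hu a ha, hw b hb, hQ a ha⟩, fun h => h.1⟩
  have far : ∀ {x y}, d x = d y → ¬ G.Adj x y := by
    intro x y hxy hadj
    have := hd.adj _ _ hadj
    omega
  refine hG.2 (2 * k) (by omega) (cycleGraph_isIndContained_of_sequence (by omega)
    (fun n => if n % 2 = 0 then u (n / 2) else w (n / 2)) ?_)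
  intro a b hab hb
  rcases Nat.mod_two_eq_zero_or_one a with ha2 | ha2 <;>
    rcases Nat.mod_two_eq_zero_or_one b with hb2 | hb2
  · simp only [ha2, hb2, if_true]
    refine iff_of_false (far ?_) (by omega)
    rw [hu _ (by omega), hu _ (by omega)]
  · simp only [ha2, hb2, if_true, one_ne_zero, if_false]
    rw [huw _ (by omega) _ (by omega)]
    omega
  · simp only [ha2, hb2, if_true, one_ne_zero, if_false]
    rw [SimpleGraph.adj_comm, huw _ (by omega) _ (by omega)]
    omega
  · simp only [ha2, hb2, one_ne_zero, if_false]
    refine iff_of_false (far ?_) (by omega)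
    rw [hw _ (by omega), hw _ (by omega)]

lemma layerRel_noHexagon (hG : IsChordalBipartite G) {d : V → ℕ} (hd : IsLayering G d) (i : ℕ)
    (Q : V → Prop) : NoHexagon (layerRel G d i Q) := by
  intro u₀ u₁ u₂ w₀ w₁ w₂ h1 h2 h3 h4 h5 h6
  by_contra! hcon
  refine layerRel_no_cycle hG hd (i := i) (Q := Q) (k := 3) le_rfl
    (fun n => if n = 0 then u₀ else if n = 1 then u₁ else u₂)
    (fun n => if n = 0 then w₀ else if n = 1 then w₁ else w₂) ?_
  intro a ha b hb
  interval_cases a <;> interval_cases b <;> simp [*]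

lemma layerRel_noOctagon (hG : IsChordalBipartite G) {d : V → ℕ} (hd : IsLayering G d) (i : ℕ)
    (Q : V → Prop) : NoOctagon (layerRel G d i Q) := by
  intro u₀ u₁ u₂ u₃ w₀ w₁ w₂ w₃ h1 h2 h3 h4 h5 h6 h7 h8
  by_contra! hcon
  refine layerRel_no_cycle hG hd (i := i) (Q := Q) (k := 4) (by omega)
    (fun n => if n = 0 then u₀ else if n = 1 then u₁ else if n = 2 then u₂ else u₃)
    (fun n => if n = 0 then w₀ else if n = 1 then w₁ else if n = 2 then w₂ else w₃) ?_
  intro a ha b hb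
  interval_cases a <;> interval_cases b <;> simp [*]

/-- If the vertices in question have a common neighbour in the previous layer, then the edges
towards the next layer contain no induced matching of size 3. -/
lemma layerRel_noTripleMatching (hS : IsInducedFree spider222 G) {d : V → ℕ}
    (hd : IsLayering G d) {i : ℕ} {z : V} (hz : d z = i) :
    NoTripleMatching (layerRel G d (i + 1) fun u => G.Adj z u) := by
  intro u₀ u₁ u₂ w₀ w₁ w₂ h0 h1 h2
  by_contra! hcon
  have neg : ∀ {u w u' w'}, layerRel G d (i + 1) (fun u => G.Adj z u) u w' →
      layerRel G d (i + 1) (fun u => G.Adj z u) u' w →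
      ¬ layerRel G d (i + 1) (fun u => G.Adj z u) u w → ¬ G.Adj u w :=
    fun h h' hn hadj => hn ⟨hadj, h.2.1, h'.2.2.1, h.2.2.2⟩
  obtain ⟨n01, n10, n02, n20, n12, n21⟩ := hcon
  exact hS (spider222_isIndContained hd hz h0.2.1 h1.2.1 h2.2.1 h0.2.2.1 h1.2.2.1 h2.2.2.1
    h0.2.2.2 h1.2.2.2 h2.2.2.2 h0.1 h1.1 h2.1 (neg h0 h1 n01) (neg h0 h2 n02) (neg h1 h0 n10)
    (neg h1 h2 n12) (neg h2 h0 n20) (neg h2 h1 n21))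

/-- Inside one component of the layers from `i` on, the edges between the layers `i` and `i + 1`
are given by four pairs of thresholds. -/
theorem IsLayering.exists_thresholds [Finite V] {d : V → ℕ} (hd : IsLayering G d)
    (hG : IsChordalBipartite G) (hS : IsInducedFree spider222 G) (i : ℕ) (u₀ : V) :
    ∃ a b : Fin 2 × Fin 2 → V → ℕ, (∀ k v, a k v ≤ Nat.card V) ∧ (∀ k v, b k v ≤ Nat.card V) ∧
      ∀ u w, d u = i → d w = i + 1 → (G.edgesWithin {z | i ≤ d z}).Reachable u₀ u →
        (G.Adj u w ↔ ∃ k, b k w ≤ a k u) := by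
  -- Each class consists of the children of one of two dominating parents. In layer 0 the component
  -- contains a single root, so all edges share their left end. Two classes with two chains each
  -- give four thresholds.
  have cover : ∃ Q : Fin 2 → V → Prop, (∀ k, NoTripleMatching (layerRel G d i (Q k))) ∧
      ∀ u, d u = i → (G.edgesWithin {z | i ≤ d z}).Reachable u₀ u → ∃ k, Q k u := by
    by_cases hu₀ : ∃ u, d u = i ∧ (G.edgesWithin {z | i ≤ d z}).Reachable u₀ u
    · obtain ⟨u₁, hu₁, hr₁⟩ := hu₀
      rcases i with _ | i
      · refine ⟨fun _ u => u = u₁, fun _ => ?_, fun u hu hr => ⟨0, ?_⟩⟩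
        · rintro u₀ u₁ u₂ w₀ w₁ w₂ ⟨a1, a2, a3, rfl⟩ ⟨b1, b2, b3, rfl⟩ -
          exact Or.inl ⟨b1, a2, b3, rfl⟩
        · exact hd.root _ _ hu hu₁ ((hr.symm.trans hr₁).mono (G.edgesWithin_le _))
      · obtain ⟨p, q, hp, hq, hpq⟩ := hd.exists_two_parents hG hS i u₁ hu₁
        refine ⟨![G.Adj p, G.Adj q], fun k => ?_, fun u hu hr => ?_⟩
        · fin_cases k
          · exact layerRel_noTripleMatching hS hd hp
          · exact layerRel_noTripleMatching hS hd hq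
        · rcases hpq u hu (hr₁.symm.trans hr) with h | h
          · exact ⟨0, h⟩
          · exact ⟨1, h⟩
    · refine ⟨fun _ _ => False, fun _ => ?_, fun u hu hr => absurd ⟨u, hu, hr⟩ hu₀⟩
      rintro u₀ u₁ u₂ w₀ w₁ w₂ ⟨-, -, -, h⟩
      exact h.elim
  obtain ⟨Q, hQ, hcov⟩ := cover
  choose a b ha hb hab using fun k => exists_two_thresholds
    (layerRel_noHexagon hG hd i (Q k)) (layerRel_noOctagon hG hd i (Q k)) (hQ k)
  refine ⟨fun k => a k.1 k.2, fun k => b k.1 k.2, fun k => ha k.1 k.2, fun k => hb k.1 k.2,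
    fun u w hu hw hr => ⟨fun h => ?_, ?_⟩⟩
  · obtain ⟨k, hk⟩ := hcov u hu hr
    obtain ⟨l, hl⟩ := (hab k u w).1 ⟨h, hu, hw, hk⟩
    exact ⟨(k, l), hl⟩
  · rintro ⟨⟨k, l⟩, hkl⟩
    exact ((hab k u w).2 ⟨l, hkl⟩).1

end Layers

/-! ### Assembling the labels -/

/-- The decoder on tuples: `x` belongs to a vertex of some layer, `y` to a vertex of the next layer
in the same component, and one of the thresholds is reached. -/
def LayerCodeAdj (x y : Fin 3 ⊕ (Fin 2 × Fin 2) ⊕ (Fin 2 × Fin 2) → ℕ) : Prop :=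
  y (Sum.inl 0) = x (Sum.inl 0) + 1 ∧ x (Sum.inl 1) = y (Sum.inl 2) ∧
    ∃ k, y (Sum.inr (Sum.inr k)) ≤ x (Sum.inr (Sum.inl k))

theorem mainTheorem8 :
    AdmitsImplicitRepresentation.{u}
      (fun _ G => IsChordalBipartite G ∧ IsInducedFree spider222 G) := by
  refine admitsImplicitRepresentation_of_tuples
    (fun x y => LayerCodeAdj x y ∨ LayerCodeAdj y x) ?_
  rintro V _ G ⟨hG, hS⟩
  obtain ⟨d, hd, hle⟩ := exists_isLayering hG.1
  choose a b ha hb hab using fun i u₀ => hd.exists_thresholds hG hS i u₀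
  let rep : ℕ → V → V := fun i v =>
    ((G.edgesWithin {z | i ≤ d z}).connectedComponentMk v).out
  have hrep : ∀ i v, (G.edgesWithin {z | i ≤ d z}).Reachable (rep i v) v := fun i v =>
    SimpleGraph.ConnectedComponent.exact (Quot.out_eq _)
  have hsame : ∀ {i x y}, (G.edgesWithin {z | i ≤ d z}).Reachable x y → rep i x = rep i y :=
    fun h => by simp only [rep, SimpleGraph.ConnectedComponent.sound h]
  let idx : V → ℕ := fun v => Finite.equivFin V v
  have hidx : ∀ {x y}, idx x = idx y → x = y := fun h =>
    (Finite.equivFin V).injective (Fin.ext h)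
  -- A vertex stores data for both of its roles: as upper end, in its component of the layers from
  -- `d v` on, and as lower end, in that of the layers from `d v - 1` on. For `d v = 0` the
  -- truncated subtraction is harmless, since a lower end never lies in layer 0. Comparing component
  -- indices ensures that only thresholds of the same family are compared.
  let f : V → Fin 3 ⊕ (Fin 2 × Fin 2) ⊕ (Fin 2 × Fin 2) → ℕ := fun v =>
    Sum.elim ![d v, idx (rep (d v) v), idx (rep (d v - 1) v)]
      (Sum.elim (fun k => a (d v) (rep (d v) v) k v)
        (fun k => b (d v - 1) (rep (d v - 1) v) k v))
  have key : ∀ v w, LayerCodeAdj (f v) (f w) ↔ d w = d v + 1 ∧ G.Adj v w := by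
    intro v w
    have expand : LayerCodeAdj (f v) (f w) ↔ d w = d v + 1 ∧
        idx (rep (d v) v) = idx (rep (d w - 1) w) ∧
        ∃ k, b (d w - 1) (rep (d w - 1) w) k w ≤ a (d v) (rep (d v) v) k v := Iff.rfl
    rw [expand]
    refine and_congr_right fun hdw => ?_
    have hpred : d w - 1 = d v := by omega
    rw [hpred]
    constructor
    · rintro ⟨h1, h2⟩
      rw [← hidx h1] at h2
      exact (hab _ _ v w rfl hdw (hrep _ v)).2 h2
    · intro hadj
      have hvw : rep (d v) v = rep (d v) w :=
        hsame (SimpleGraph.Adj.reachable ⟨hadj, le_refl (d v), show d v ≤ d w by omega⟩)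
      refine ⟨congrArg idx hvw, ?_⟩
      rw [← hvw]
      exact (hab _ _ v w rfl hdw (hrep _ v)).1 hadj
  refine ⟨f, fun v i => ?_, fun v w _ => ?_⟩
  · have hi : ∀ x, idx x ≤ Nat.card V := fun x => (Finite.equivFin V x).2.le
    rcases i with i | k | k
    · fin_cases i
      · exact hle v
      · exact hi _
      · exact hi _
    · exact ha _ _ _ _
    · exact hb _ _ _ _
  · rw [key, key, SimpleGraph.adj_comm G w v, ← or_and_right]
    exact ⟨fun h => ⟨hd.adj v w h, h⟩, fun h => h.2⟩
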